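/- **Conventions.** Filtrations $\mathcal F=(\mathcal F_n)_{n\le 0}$ are indexed by the nonpositive integers. $\mathcal F$ is *immersed* in $\mathcal G$ if $\mathcal F_n\subset\mathcal G_n$ for all $n\le 0$ and, for each $n<0$, $\mathcal F_{n+1}$ is conditionally independent of $\mathcal G_n$ given $\mathcal F_n$. A filtration is of *product type* if it is generated by a sequence of independent random variables. A filtration is *standard* if, up to isomorphism (that is, after replacing a process generating it by a copy of that process, with the same law, on some probability space), it is immersed in a filtration of product type. A *parameterization* of $\mathcal F$ is a sequence of random variables $(U_n)_{n\le0}$ such that, for each $n\le 0$, $U_n$ is independent of $\mathcal F_{n-1}\vee\sigma(U_m;\,m\le n-1)$ and $\mathcal F_n\subset\mathcal F_{n-1}\vee\sigma(U_n)$; it is *generating* if $\mathcal F_n\subset\sigma(U_m;\,m\le n)$ for all $n\le 0$. Let $d\ge 2$ be an integer or $d=\infty$. The $d$-dimensional Pascal graph has, at each level $n\le 0$, the vertices $v=(v(i))_{1\le i\le d}$ ($i\ge1$ if $d=\infty$) with natural number entries, finitely many nonzero, such that $\sum_i v(i)=|n|$; a vertex $u$ at level $n$ and a vertex $v$ at level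 $n-1$ are connected (by a single edge) if and only if $\sum_i|u(i)-v(i)|=1$. A path is a sequence $(V_n)_{n\le 0}$ with $V_n$ a vertex at level $n$ and $V_n,V_{n-1}$ connected for each $n\le0$. A probability measure $\mu$ on the space of paths is *central* if, for each $n<0$, given $\sigma(V_m;\,m\le n)$ the conditional law of $(V_n,\ldots,V_0)$ is uniform on the set of paths connecting the vertex $V_n$ to the root. It is *ergodic* if the tail $\sigma$-field $\bigcap_{n\le 0}\sigma(V_m;\,m\le n)$ is degenerate, that is, each of its events has probability $0$ or $1$. Given a probability vector $\theta=(\theta_i)_{1\le i\le d}$, $\mu$ is the *multinomial central measure* with parameter $\theta$ if $\mu$ is central and $$\mu(V_{n-1}=v+e_i\mid V_n=v)=\theta_i$$ for all $n\le 0$, all $i$, and all $v$ with $\mu(V_n=v)>0$, where $e_i$ is the $i$-th unit vector. **Proposition.** Let $d\ge2$ be an integer or $d=\infty$, let $\theta$ be a probability vector indexed by the coordinates $1\le i\le d$, and let $\mu$ be the multinomial central measure with parameter $\theta$. Then: 1. the $d$-dimensional Pascal filtration, generated by $(V_n)_{n\le 0}$ under $\mu$, is standard; 2. $\mu$ is ergodic;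 3. on some probability space there are a copy $(V'_n)_{n\le 0}$ of $(V_n)_{n\le 0}$ and random variables $(U_n)_{n\le 0}$, where $U_{n+1}$ is uniformly distributed on $\{1,\ldots,|n|\}$ for each $n<0$, such that $(U_n)_{n\le 0}$ is a generating parameterization of the filtration generated by $(V'_n)_{n\le0}$ and, for each $n<0$, almost surely $V'_{n+1}=V'_n-e_i$, where $i$ is the unique index with $$\sum_{j<i}V'_n(j)<U_{n+1}\le\sum_{j\le i}V'_n(j).$$ -/

import Mathlib

open MeasureTheory ProbabilityTheory OrderDual

/-!  Filtrations in discrete negative time.  The time `n ≤ 0` is represented by the natural number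
`k = -n`, read in `ℕᵒᵈ`: a filtration `F` has `σ`-fields `F (toDual k)`, increasing in the time
`-k`, so that the time preceding `k` is `k + 1`. -/

section Filtrations

universe u

variable {Ω : Type u} {mΩ : MeasurableSpace Ω}

/-- The filtration generated by a process: at time `-k` it is `σ(X_m : m ≥ k)`. -/
def generatedFiltration {E : ℕ → Type u} [∀ k, MeasurableSpace (E k)] (X : ∀ k, Ω → E k)
    (hX : ∀ k, Measurable (X k)) : Filtration ℕᵒᵈ mΩ where
  seq k := ⨆ m : ℕ, ⨆ _ : ofDual k ≤ m, MeasurableSpace.comap (X m) inferInstance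
  mono' := by
    intro a b hab
    exact iSup_mono fun m => iSup_mono' fun h => ⟨le_trans (ofDual_le_ofDual.2 hab) h, le_rfl⟩
  le' := fun _ => iSup_le fun m => iSup_le fun _ => (hX m).comap_le

/-- Conditional independence of the `σ`-fields `m₁` and `m₂` given the `σ`-field `m'`, on an
arbitrary probability space. -/
def CondIndepSigma {Ω : Type u} (m' m₁ m₂ : MeasurableSpace Ω) {mΩ : MeasurableSpace Ω}
    (μ : Measure Ω) : Prop :=
  ∀ A B : Set Ω, MeasurableSet[m₁] A → MeasurableSet[m₂] B →
    μ[(A ∩ B).indicator (fun _ => (1 : ℝ)) | m'] =ᵐ[μ]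
      μ[A.indicator (fun _ => (1 : ℝ)) | m'] * μ[B.indicator (fun _ => (1 : ℝ)) | m']

/-- `F` is immersed in `G`: `F ⊆ G`, and for every time `n < 0` the `σ`-field `F_{n+1}` is
conditionally independent of `G_n` given `F_n` (with `n = -(k+1)`). -/
def IsImmersed (F G : Filtration ℕᵒᵈ mΩ) (μ : Measure Ω) : Prop :=
  F ≤ G ∧ ∀ k : ℕ, CondIndepSigma (F (toDual (k + 1))) (F (toDual k)) (G (toDual (k + 1))) μ

/-- A filtration is of product type if it is generated by a sequence of independent random
variables. -/
def IsProductType (G : Filtration ℕᵒᵈ mΩ) (μ : Measure Ω) : Prop :=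
  ∃ (S : ℕ → Type u) (_ : ∀ k, MeasurableSpace (S k)) (U : ∀ k, Ω → S k)
    (hU : ∀ k, Measurable (U k)), iIndepFun U μ ∧ G = generatedFiltration U hU

/-- Two filtrations, on possibly different probability spaces, are isomorphic if one is generated
by some process and the other one by a copy of that process, i.e. by a process with the same
law. -/
def IsIsomorphic (F : Filtration ℕᵒᵈ mΩ) (μ : Measure Ω) {Ω' : Type u} {mΩ' : MeasurableSpace Ω'}
    (F' : Filtration ℕᵒᵈ mΩ') (μ' : Measure Ω') : Prop :=
  ∃ (E : ℕ → Type u) (_ : ∀ k, MeasurableSpace (E k))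
    (X : ∀ k, Ω → E k) (hX : ∀ k, Measurable (X k))
    (X' : ∀ k, Ω' → E k) (hX' : ∀ k, Measurable (X' k)),
    F = generatedFiltration X hX ∧ F' = generatedFiltration X' hX' ∧
      IdentDistrib (fun ω k => X k ω) (fun ω k => X' k ω) μ μ'

/-- A filtration is standard if, up to isomorphism, it is immersed in a filtration of product
type. -/
def IsStandard (F : Filtration ℕᵒᵈ mΩ) (μ : Measure Ω) : Prop :=
  ∃ (Ω' : Type u) (mΩ' : MeasurableSpace Ω') (μ' : Measure Ω') (F' G : Filtration ℕᵒᵈ mΩ'),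
    IsProbabilityMeasure μ' ∧ IsIsomorphic F μ F' μ' ∧ IsProductType G μ' ∧ IsImmersed F' G μ'

/-- A filtration is Kolmogorovian if its tail `σ`-field is degenerate. -/
def IsKolmogorovian (F : Filtration ℕᵒᵈ mΩ) (μ : Measure Ω) : Prop :=
  ∀ A : Set Ω, MeasurableSet[⨅ k : ℕ, F (toDual k)] A → μ A = 0 ∨ μ A = 1

/-- `U` is a parameterization of `F`: for every time `n`, `U_n` is independent of
`F_{n-1} ∨ σ(U_m : m ≤ n-1)`, and `F_n ⊆ F_{n-1} ∨ σ(U_n)`. -/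
def IsParameterization {S : ℕ → Type u} [∀ k, MeasurableSpace (S k)] (F : Filtration ℕᵒᵈ mΩ)
    (U : ∀ k, Ω → S k) (hU : ∀ k, Measurable (U k)) (μ : Measure Ω) : Prop :=
  ∀ k : ℕ,
    Indep (MeasurableSpace.comap (U k) inferInstance)
      (F (toDual (k + 1)) ⊔ generatedFiltration U hU (toDual (k + 1))) μ ∧
    F (toDual k) ≤ F (toDual (k + 1)) ⊔ MeasurableSpace.comap (U k) inferInstance

/-- A parameterization `U` of `F` is generating if `F ⊆ 𝓤`, where `𝓤` is the filtration generated
by `U`. -/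
def IsGeneratingParameterization {S : ℕ → Type u} [∀ k, MeasurableSpace (S k)]
    (F : Filtration ℕᵒᵈ mΩ) (U : ∀ k, Ω → S k) (hU : ∀ k, Measurable (U k))
    (μ : Measure Ω) : Prop :=
  IsParameterization F U hU μ ∧ F ≤ generatedFiltration U hU

end Filtrations

namespace Pascal

/-- The coordinates `0, 1, …, d - 1` (all natural numbers when `d = ∞`). -/
abbrev Coord (d : ℕ∞) : Type := {i : ℕ // (i : ℕ∞) < d}

/-- Vertices of the `d`-dimensional Pascal graph: vectors of natural numbers indexed by the
coordinates, with finitely many nonzero terms. -/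
abbrev Vertex (d : ℕ∞) : Type := Coord d →₀ ℕ

/-- The discrete `σ`-field on the countable set of vertices. -/
instance instMeasurableSpaceVertex (d : ℕ∞) : MeasurableSpace (Vertex d) := ⊤

/-- The vertices at level `-k` are those whose coordinates sum to `k`. -/
def level (d : ℕ∞) (k : ℕ) : Set (Vertex d) := {v | ∑ i ∈ v.support, v i = k}

/-- Two vertices at consecutive levels are connected iff `∑ |u_i - v_i| = 1`. -/
def Adj {d : ℕ∞} (u v : Vertex d) : Prop :=
  ∑ i ∈ u.support ∪ v.support, |(u i : ℤ) - (v i : ℤ)| = 1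

/-- Infinite paths starting at the root, given by their vertices `γ k` at the levels `-k` (the
graph has no multiple edges).  The `σ`-field is the one generated by the coordinates. -/
abbrev Path (d : ℕ∞) : Type :=
  {γ : ℕ → Vertex d // (∀ k, γ k ∈ level d k) ∧ ∀ k, Adj (γ k) (γ (k + 1))}

/-- The vertex of a path at level `-k`: the random walk `V_{-k}` on the path space. -/
def walk (d : ℕ∞) (k : ℕ) (γ : Path d) : Vertex d := γ.1 k

theorem measurable_walk (d : ℕ∞) (k : ℕ) : Measurable (walk d k) :=
  (measurable_pi_apply k).comp measurable_subtype_coe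

/-- The `d`-dimensional Pascal filtration, generated by the random walk on the vertices. -/
def filtration (d : ℕ∞) : Filtration ℕᵒᵈ (inferInstance : MeasurableSpace (Path d)) :=
  generatedFiltration (walk d) (measurable_walk d)

/-- `w` is a finite path connecting the root to a vertex at level `-k`. -/
def IsFinitePath {d : ℕ∞} {k : ℕ} (w : Fin (k + 1) → Vertex d) : Prop :=
  (∀ j : Fin (k + 1), w j ∈ level d j) ∧ ∀ j : Fin k, Adj (w j.castSucc) (w j.succ)

/-- The number of paths connecting the vertex `v` at level `-k` to the root. -/
noncomputable def dim {d : ℕ∞} (k : ℕ) (v : Vertex d) : ℕ :=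
  Nat.card {w : Fin (k + 1) → Vertex d // IsFinitePath w ∧ w (Fin.last k) = v}

/-- A measure on the path space is central if, for every `k`, the conditional distribution of the
part of the path between the levels `-k` and `0` given the `σ`-field at time `-k` is uniform on the
set of paths connecting `V_{-k}` to the root. -/
def IsCentral {d : ℕ∞} (μ : Measure (Path d)) : Prop :=
  ∀ (k : ℕ) (w : Fin (k + 1) → Vertex d), IsFinitePath w →
    μ[{γ : Path d | ∀ j : Fin (k + 1), walk d j γ = w j}.indicator (fun _ => (1 : ℝ)) |
        filtration d (toDual k)] =ᵐ[μ]
      {γ : Path d | walk d k γ = w (Fin.last k)}.indicator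
        (fun γ => 1 / (dim k (walk d k γ) : ℝ))

/-- A central measure is ergodic if the filtration is Kolmogorovian. -/
def IsErgodic {d : ℕ∞} (μ : Measure (Path d)) : Prop := IsKolmogorovian (filtration d) μ

/-- `θ` is a probability vector. -/
def IsProbVector {d : ℕ∞} (θ : Coord d → ℝ) : Prop := (∀ i, 0 ≤ θ i) ∧ HasSum θ 1

/-- `μ` is the multinomial central measure with parameter `θ`: it is central, and every transition
from level `-k` to level `-(k+1)` adds `e_i` with probability `θ i`. -/
def IsMultinomialCentral {d : ℕ∞} (θ : Coord d → ℝ) (μ : Measure (Path d)) : Prop :=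
  IsCentral μ ∧ ∀ (k : ℕ) (v : Vertex d) (i : Coord d), μ {γ | walk d k γ = v} ≠ 0 →
    (μ[|{γ | walk d k γ = v}]).real {γ | walk d (k + 1) γ = v + Finsupp.single i 1} = θ i

/-- The updating rule from level `-(k+1)` to level `-k`: with `v̄(i) = v(0) + ⋯ + v(i)`, the vertex
`v` and the number `u` are sent to `w = v - e_i` for the index `i` with
`v̄(i-1) < u ≤ v̄(i)`. -/
def IsUpdate {d : ℕ∞} (v : Vertex d) (u : ℕ) (w : Vertex d) : Prop :=
  ∃ i : Coord d, ∑ j ∈ v.support with j < i, v j < u ∧ u ≤ ∑ j ∈ v.support with j ≤ i, v j ∧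
    v = w + Finsupp.single i 1

end Pascal

/-! Under the multinomial measure the path counts, level by level, independent letters of law `θ`.
Write the letters as `c (x j)`, where the `x j` are independent uniform variables and `c` is the
nondecreasing quantile function of `θ`. The relative rank of `x k` among `x 0, …, x k` (`code x k`)
plays the role of `U` at time `-k`. By exchangeability these ranks are independent, and the rank at
time `-k` is uniform on `1, …, k + 1` (`map_code`).

Since `c` is monotone, sorting the first `k + 1` values also sorts their letters. Going from level
`k + 1` to level `k` deletes the value of rank `U`, hence the letter in position `U` of the sorted
word: this is the updating rule (`isUpdate_vertex`).

The parameterization is generating because the vertex at level `k` depends only on the codes from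
`k` on. These tell how each rank `r ≤ k` moves under later insertions; by the strong law the rank
divided by the level tends to the value `x j` that had rank `r` (`IsEquidistributed.freq_code`), so
the letters and their counts are recovered without the order in which the first `k` values arrived.

Centrality and the transition probabilities give each finite path a mass bounded by the product of
the `θ i` along it, and this identifies the law of the walk with that of the construction
(`IsMultinomialCentral.map_walk`). Immersion in the filtration of the codes yields standardness, and
Kolmogorov's zero-one law for the codes yields ergodicity. -/

namespace Pascal

/-! ### Relative ranks under successive insertions and their asymptotic positions -/

open Filter Topology
open scoped ENNReal

/-- The relative rank, after the insertion of a new element of rank `u`, of the element whose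
relative rank was `r`. -/
def bump (u r : ℕ) : ℕ := if u ≤ r then r + 1 else r

theorem bump_mono (u : ℕ) : Monotone (bump u) := by
  intro r s h
  unfold bump
  split_ifs <;> omega

theorem bump_injective (u : ℕ) : Function.Injective (bump u) := by
  intro r s h
  unfold bump at h
  split_ifs at h <;> omega

theorem bump_mem_Icc {u k r : ℕ} (hr : r ∈ Finset.Icc 1 k) : bump u r ∈ Finset.Icc 1 (k + 1) := by
  rw [Finset.mem_Icc] at *
  unfold bump
  split_ifs <;> omega

theorem insert_image_bump {u k : ℕ} (hu : u ∈ Finset.Icc 1 (k + 1)) :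
    insert u ((Finset.Icc 1 k).image (bump u)) = Finset.Icc 1 (k + 1) := by
  ext r
  simp only [Finset.mem_insert, Finset.mem_image, Finset.mem_Icc] at *
  constructor
  · rintro (rfl | ⟨s, hs, rfl⟩)
    · exact hu
    · exact Finset.mem_Icc.1 (bump_mem_Icc (Finset.mem_Icc.2 hs))
  · intro hr
    rcases lt_trichotomy r u with h | h | h
    · exact .inr ⟨r, by omega, by simp [bump]; omega⟩
    · exact .inl h
    · exact .inr ⟨r - 1, by omega, by unfold bump; split_ifs <;> omega⟩

theorem notMem_image_bump (u k : ℕ) : u ∉ (Finset.Icc 1 k).image (bump u) := by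
  simp only [Finset.mem_image, not_exists, not_and]
  intro r _ h
  unfold bump at h
  split_ifs at h <;> omega

/-- The relative rank at level `k + n` of the element whose relative rank at level `k` is `r`,
when the successive insertions take place at the ranks `u k, u (k + 1), …`. -/
def lift (u : ℕ → ℕ) : ℕ → ℕ → ℕ → ℕ
  | _, r, 0 => r
  | k, r, n + 1 => lift u (k + 1) (bump (u k) r) n

theorem lift_mono (u : ℕ → ℕ) (k n : ℕ) : Monotone fun r => lift u k r n := by
  induction n generalizing k with
  | zero => exact fun _ _ h => h
  | succ n ih => exact fun r s h => ih (k + 1) (bump_mono _ h)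

theorem lift_congr {u u' : ℕ → ℕ} {k n : ℕ} (r : ℕ) (h : ∀ j < k + n, u j = u' j) :
    lift u k r n = lift u' k r n := by
  induction n generalizing k r with
  | zero => rfl
  | succ n ih =>
    simp only [lift]
    rw [h k (by omega)]
    exact ih _ fun j hj => h j (by omega)

/-- The asymptotic relative position of the element whose relative rank at level `k` is `r`. -/
noncomputable def freq (u : ℕ → ℕ) (k r : ℕ) : ℝ≥0∞ :=
  limsup (fun n : ℕ => (lift u k r n : ℝ≥0∞) / ((k + n : ℕ) : ℝ≥0∞)) atTop

theorem freq_mono (u : ℕ → ℕ) (k : ℕ) : Monotone (freq u k) := by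
  intro r s h
  refine limsup_le_limsup (Eventually.of_forall fun n => ?_)
  have : lift u k r n ≤ lift u k s n := lift_mono u k n h
  dsimp only
  gcongr

/-- Lifting from `k + 1` after one insertion is lifting from `k` with the first term dropped, and a
limsup ignores that term. The position thus belongs to the element, not to the level at which it is
observed. -/
theorem freq_bump (u : ℕ → ℕ) (k r : ℕ) : freq u (k + 1) (bump (u k) r) = freq u k r := by
  unfold freq
  rw [← limsup_nat_add (fun n : ℕ => (lift u k r n : ℝ≥0∞) / ((k + n : ℕ) : ℝ≥0∞)) 1]
  congr 1
  ext n
  rw [show k + 1 + n = k + (n + 1) by omega]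
  rfl

/-- All the asymptotic positions lie in the open unit interval. -/
def IsProper (u : ℕ → ℕ) : Prop := ∀ k, ∀ r ∈ Finset.Icc 1 k, freq u k r ∈ Set.Ioo 0 1

/-- By `freq_bump`, positions at level `k` reappear among those at every higher level, so low levels
impose no extra condition. This makes properness an event of the codes from `m` on. -/
theorem isProper_iff_shift (u : ℕ → ℕ) (m : ℕ) :
    IsProper u ↔ ∀ k, ∀ r ∈ Finset.Icc 1 (m + k), freq u (m + k) r ∈ Set.Ioo 0 1 := by
  refine ⟨fun h k => h _, fun h k => ?_⟩
  have key : ∀ n k, (∀ r ∈ Finset.Icc 1 (k + n), freq u (k + n) r ∈ Set.Ioo 0 1) →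
      ∀ r ∈ Finset.Icc 1 k, freq u k r ∈ Set.Ioo 0 1 := by
    intro n
    induction n with
    | zero => exact fun _ h => h
    | succ n ih =>
      refine fun k h => ih k fun r hr => ?_
      rw [← freq_bump]
      exact h _ (bump_mem_Icc hr)
  exact key m k (by simpa [add_comm] using h k)

/-! ### Letters, vertices and the updating rule -/

variable {d : ℕ∞} (c : ℝ → Coord d) (i₀ : Coord d)

open Classical in
/-- The letter carried by the element of relative rank `r` at level `k`. -/
noncomputable def letter (u : ℕ → ℕ) (k r : ℕ) : Coord d :=
  -- The test bears on the whole sequence: in the exceptional case all letters equal `i₀`, so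
  -- monotonicity in the rank, and with it the updating rule, holds surely and not only almost
  -- surely.
  if IsProper u then c (freq u k r).toReal else i₀

/-- The vertex at level `k` counts the letters carried by the `k` elements. -/
noncomputable def vertex (u : ℕ → ℕ) (k : ℕ) : Vertex d :=
  ∑ r ∈ Finset.Icc 1 k, Finsupp.single (letter c i₀ u k r) 1

theorem letter_bump (u : ℕ → ℕ) (k r : ℕ) :
    letter c i₀ u (k + 1) (bump (u k) r) = letter c i₀ u k r := by
  rw [letter, letter, freq_bump]

variable {c} in
theorem letter_le_letter (hc : MonotoneOn c (Set.Ioo 0 1)) (u : ℕ → ℕ) {k r s : ℕ}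
    (hr : r ∈ Finset.Icc 1 k) (hs : s ∈ Finset.Icc 1 k) (h : r ≤ s) :
    letter c i₀ u k r ≤ letter c i₀ u k s := by
  unfold letter
  split_ifs with hu
  · have key : ∀ t ∈ Finset.Icc 1 k, (freq u k t).toReal ∈ Set.Ioo (0 : ℝ) 1 := fun t ht => by
      obtain ⟨h0, h1⟩ := hu k t ht
      refine ⟨ENNReal.toReal_pos h0.ne' (h1.trans ENNReal.one_lt_top).ne, ?_⟩
      rw [← ENNReal.toReal_one]
      exact (ENNReal.toReal_lt_toReal (h1.trans ENNReal.one_lt_top).ne ENNReal.one_ne_top).2 h1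
    exact hc (key r hr) (key s hs)
      (ENNReal.toReal_mono ((hu k s hs).2.trans ENNReal.one_lt_top).ne (freq_mono u k h))
  · exact le_rfl

theorem vertex_succ {u : ℕ → ℕ} {k : ℕ} (hu : u k ∈ Finset.Icc 1 (k + 1)) :
    vertex c i₀ u (k + 1) =
      vertex c i₀ u k + Finsupp.single (letter c i₀ u (k + 1) (u k)) 1 := by
  unfold vertex
  rw [← insert_image_bump hu, Finset.sum_insert (notMem_image_bump _ _),
    Finset.sum_image (bump_injective _).injOn, add_comm]
  simp only [letter_bump]

theorem sum_filter_support_sum_single {ι α : Type*} (s : Finset ι) (f : ι → α) (p : α → Prop)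
    [DecidablePred p] :
    ∑ j ∈ (∑ r ∈ s, Finsupp.single (f r) 1 : α →₀ ℕ).support with p j,
      (∑ r ∈ s, Finsupp.single (f r) 1 : α →₀ ℕ) j = (s.filter fun r => p (f r)).card := by
  classical
  have key (v : α →₀ ℕ) : ∑ j ∈ v.support with p j, v j = (v.filter p).degree := by
    rw [Finsupp.degree_apply, Finsupp.support_filter]
    exact Finset.sum_congr rfl fun j hj => by simp [(Finset.mem_filter.1 hj).2]
  rw [key, Finsupp.filter_sum, map_sum, Finset.card_filter]
  refine Finset.sum_congr rfl fun r _ => ?_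
  by_cases h : p (f r) <;> simp [h]

variable {c} in
-- Letters are nondecreasing in the rank. Those strictly below the letter of rank `u k` therefore
-- have rank at most `u k - 1`, while the ranks `1, …, u k` all carry letters at most equal to it.
theorem isUpdate_vertex (hc : MonotoneOn c (Set.Ioo 0 1)) {u : ℕ → ℕ} {k : ℕ}
    (hu : u k ∈ Finset.Icc 1 (k + 1)) :
    IsUpdate (vertex c i₀ u (k + 1)) (u k) (vertex c i₀ u k) := by
  have h1 := Finset.mem_Icc.1 hu
  refine ⟨letter c i₀ u (k + 1) (u k), ?_, ?_, vertex_succ c i₀ hu⟩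
  · unfold vertex
    rw [sum_filter_support_sum_single]
    calc _ ≤ (Finset.Icc 1 (u k - 1)).card := Finset.card_le_card fun r hr => by
            rw [Finset.mem_filter] at hr
            have := Finset.mem_Icc.1 hr.1
            by_contra hcon
            rw [Finset.mem_Icc] at hcon
            exact (letter_le_letter i₀ hc u hu hr.1 (by omega)).not_gt hr.2
      _ < u k := by simp; omega
  · unfold vertex
    rw [sum_filter_support_sum_single]
    calc u k = (Finset.Icc 1 (u k)).card := by simp
      _ ≤ _ := Finset.card_le_card fun r hr => by
            rw [Finset.mem_Icc] at hr
            have hr' : r ∈ Finset.Icc 1 (k + 1) := Finset.mem_Icc.2 (by omega)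
            exact Finset.mem_filter.2 ⟨hr', letter_le_letter i₀ hc u hr' hu hr.2⟩

/-! ### Edges of the Pascal graph and uniqueness of the update -/

theorem mem_level_iff {k : ℕ} {v : Vertex d} : v ∈ level d k ↔ v.degree = k := by
  rw [Finsupp.degree_apply]
  rfl

theorem vertex_mem_level (u : ℕ → ℕ) (k : ℕ) : vertex c i₀ u k ∈ level d k := by
  simp [mem_level_iff, vertex, map_sum]

theorem adj_add_single (v : Vertex d) (i : Coord d) : Adj v (v + Finsupp.single i 1) := by
  classical
  unfold Adj
  rw [Finset.sum_eq_single i]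
  · simp
  · intro j _ hj
    simp [hj.symm]
  · intro h
    simp at h

/-- Both `|v i - w i|` and `w i - v i` sum to `1`, and the first dominates the second termwise;
hence they agree, `v ≤ w`, and the difference has degree `1`. -/
theorem exists_eq_add_single {k : ℕ} {v w : Vertex d} (hv : v ∈ level d k)
    (hw : w ∈ level d (k + 1)) (h : Adj v w) : ∃ i, w = v + Finsupp.single i 1 := by
  classical
  have hv' : ∑ i ∈ v.support ∪ w.support, (v i : ℤ) = k := by
    rw [← Finset.sum_subset Finset.subset_union_left fun i _ hi => by
      rw [Finsupp.notMem_support_iff.1 hi, Nat.cast_zero]]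
    exact_mod_cast hv
  have hw' : ∑ i ∈ v.support ∪ w.support, (w i : ℤ) = k + 1 := by
    rw [← Finset.sum_subset Finset.subset_union_right fun i _ hi => by
      rw [Finsupp.notMem_support_iff.1 hi, Nat.cast_zero]]
    exact_mod_cast hw
  have h0 : ∑ i ∈ v.support ∪ w.support, (|(v i : ℤ) - w i| - (w i - v i)) = 0 := by
    rw [Finset.sum_sub_distrib, Finset.sum_sub_distrib, hv', hw']
    unfold Adj at h
    omega
  rw [Finset.sum_eq_zero_iff_of_nonneg fun i _ => by
    rw [abs_sub_comm]; exact sub_nonneg.2 (le_abs_self _)] at h0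
  have hle : v ≤ w := fun i => by
    by_cases hi : i ∈ v.support
    · have h1 := h0 i (Finset.mem_union_left _ hi)
      have h2 := abs_nonneg ((v i : ℤ) - w i)
      omega
    · rw [Finsupp.notMem_support_iff.1 hi]
      exact Nat.zero_le _
  obtain ⟨x, rfl⟩ := exists_add_of_le hle
  rw [mem_level_iff] at hv hw
  rw [map_add, hv, Nat.add_left_cancel_iff] at hw
  have hx : x ≠ 0 := fun hx => by simp [hx] at hw
  obtain ⟨i, hi⟩ := Finsupp.support_nonempty_iff.2 hx
  obtain ⟨y, rfl⟩ : ∃ y, x = Finsupp.single i 1 + y := exists_add_of_le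
    (Finsupp.single_le_iff.2 (Nat.one_le_iff_ne_zero.2 (Finsupp.mem_support_iff.1 hi)))
  rw [map_add, Finsupp.degree_single, Nat.add_eq_left, Finsupp.degree_eq_zero_iff] at hw
  exact ⟨i, by rw [hw, add_zero]⟩

theorem IsUpdate.eq {v w w' : Vertex d} {u : ℕ} (h : IsUpdate v u w) (h' : IsUpdate v u w') :
    w = w' := by
  have key : ∀ {i j : Coord d}, ∑ l ∈ v.support with l < j, v l < u →
      u ≤ ∑ l ∈ v.support with l ≤ i, v l → j ≤ i := by
    intro i j h1 h2
    by_contra! hij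
    refine (h1.trans_le h2).not_ge (Finset.sum_le_sum_of_subset fun l hl => ?_)
    rw [Finset.mem_filter] at *
    exact ⟨hl.1, hl.2.trans_lt hij⟩
  obtain ⟨i, h1, h2, h3⟩ := h
  obtain ⟨j, h1', h2', h3'⟩ := h'
  obtain rfl : i = j := le_antisymm (key h1 h2') (key h1' h2)
  exact add_right_cancel (h3.symm.trans h3')

/-! ### Measurability with respect to the later codes only -/

section Measurability

variable {Ω : Type*} {m : MeasurableSpace Ω} {U : ℕ → Ω → ℕ} {k : ℕ}

theorem measurable_lift (hU : ∀ j, k ≤ j → Measurable (U j)) {R : Ω → ℕ} (hR : Measurable R)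
    (n : ℕ) : Measurable fun ω => lift (fun j => U j ω) k (R ω) n := by
  induction n generalizing k R with
  | zero => exact hR
  | succ n ih =>
    refine ih (fun j hj => hU j (by omega)) (R := fun ω => bump (U k ω) (R ω)) ?_
    exact (measurable_of_countable fun p : ℕ × ℕ => bump p.1 p.2).comp
      ((hU k le_rfl).prodMk hR)

theorem measurable_freq (hU : ∀ j, k ≤ j → Measurable (U j)) (r : ℕ) :
    Measurable fun ω => freq (fun j => U j ω) k r := by
  refine Measurable.limsup fun n => ?_
  exact ((measurable_of_countable fun x : ℕ => (x : ℝ≥0∞)).comp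
    (measurable_lift hU measurable_const n)).div_const _

theorem measurableSet_isProper (hU : ∀ j, k ≤ j → Measurable (U j)) :
    MeasurableSet {ω | IsProper fun j => U j ω} := by
  simp only [fun u => isProper_iff_shift u k]
  have (l r : ℕ) : MeasurableSet
      {ω | freq (fun j => U j ω) (k + l) r ∈ Set.Ioo 0 1} :=
    measurable_freq (fun j hj => hU j (by omega)) r measurableSet_Ioo
  simp only [Set.ofPred_forall]
  exact MeasurableSet.iInter fun l => MeasurableSet.iInter fun r => MeasurableSet.iInter fun _ =>
    this l r

variable {c} in
-- The `σ`-field `m` is arbitrary and only the `U j` with `k ≤ j` are assumed measurable, so `m` may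
-- be the `σ`-field they generate. This is what makes the parameterization generating.
theorem measurable_vertex (hc : Measurable c) (hU : ∀ j, k ≤ j → Measurable (U j)) :
    Measurable fun ω => vertex c i₀ (fun j => U j ω) k := by
  have h1 : Measurable fun ω => fun r : Finset.Icc 1 k => letter c i₀ (fun j => U j ω) k r := by
    refine measurable_pi_lambda _ fun r => ?_
    exact Measurable.ite (measurableSet_isProper hU)
      (hc.comp (measurable_freq hU r).ennreal_toReal) measurable_const
  have h2 : Measurable fun f : Finset.Icc 1 k → Coord d =>
      (∑ r, Finsupp.single (f r) 1 : Vertex d) := measurable_of_countable _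
  convert h2.comp h1 using 1
  ext1 ω
  exact (Finset.sum_coe_sort (Finset.Icc 1 k)
    fun r => Finsupp.single (letter c i₀ (fun j => U j ω) k r) 1).symm

end Measurability

/-! ### Ranks and codes of a sequence of reals -/

/-- The number of terms at most `x j` among `x 0, …, x (m - 1)`. -/
noncomputable def rank (x : ℕ → ℝ) (m j : ℕ) : ℕ := ((Finset.range m).filter fun i => x i ≤ x j).card

/-- The relative rank of `x k` among `x 0, …, x k`. -/
noncomputable def code (x : ℕ → ℝ) (k : ℕ) : ℕ := rank x (k + 1) k

theorem rank_le_rank {x : ℕ → ℝ} {i j : ℕ} (m : ℕ) (h : x i ≤ x j) : rank x m i ≤ rank x m j :=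
  Finset.card_le_card fun l hl => by
    rw [Finset.mem_filter] at *
    exact ⟨hl.1, hl.2.trans h⟩

theorem rank_lt_rank {x : ℕ → ℝ} {i j m : ℕ} (hj : j < m) (h : x i < x j) :
    rank x m i < rank x m j :=
  Finset.card_lt_card <| Finset.ssubset_iff_of_subset (fun l hl => by
    rw [Finset.mem_filter] at *
    exact ⟨hl.1, hl.2.trans h.le⟩) |>.2 ⟨j, by simp [hj], by simp [h]⟩

theorem rank_injOn {x : ℕ → ℝ} (hx : Function.Injective x) (m : ℕ) :
    Set.InjOn (rank x m) (Finset.range m) := by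
  intro i hi j hj h
  simp only [Finset.coe_range, Set.mem_Iio] at hi hj
  refine hx ?_
  rcases lt_trichotomy (x i) (x j) with h' | h' | h'
  · exact absurd h (rank_lt_rank hj h').ne
  · exact h'
  · exact absurd h (rank_lt_rank hi h').ne'

theorem rank_mem_Icc (x : ℕ → ℝ) {m j : ℕ} (hj : j < m) : rank x m j ∈ Finset.Icc 1 m := by
  refine Finset.mem_Icc.2 ⟨Finset.card_pos.2 ⟨j, by simp [hj]⟩, ?_⟩
  exact (Finset.card_filter_le _ _).trans_eq (Finset.card_range m)

theorem code_mem_Icc (x : ℕ → ℝ) (k : ℕ) : code x k ∈ Finset.Icc 1 (k + 1) :=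
  rank_mem_Icc x k.lt_succ_self

theorem image_rank {x : ℕ → ℝ} (hx : Function.Injective x) (m : ℕ) :
    (Finset.range m).image (rank x m) = Finset.Icc 1 m := by
  refine Finset.eq_of_subset_of_card_le (fun r hr => ?_) ?_
  · obtain ⟨j, hj, rfl⟩ := Finset.mem_image.1 hr
    exact rank_mem_Icc x (Finset.mem_range.1 hj)
  · rw [Finset.card_image_of_injOn (rank_injOn hx m)]
    simp

theorem rank_succ (x : ℕ → ℝ) (m j : ℕ) :
    rank x (m + 1) j = rank x m j + if x m ≤ x j then 1 else 0 := by
  unfold rank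
  rw [Finset.range_add_one, Finset.filter_insert]
  split_ifs
  · rw [Finset.card_insert_of_notMem (by simp)]
  · rfl

/-- For `j < m`, `x m < x j` exactly when `code x m ≤ rank x m j`, because `x j` counts itself in
its own rank while `code x m` is one more than the number of earlier terms below `x m`. -/
theorem rank_succ_eq_bump {x : ℕ → ℝ} (hx : Function.Injective x) {m j : ℕ} (hj : j < m) :
    rank x (m + 1) j = bump (code x m) (rank x m j) := by
  rw [rank_succ, bump, code, rank_succ, if_pos le_rfl]
  rcases lt_or_gt_of_ne (hx.ne hj.ne') with h | h
  · rw [if_pos h.le, if_pos (Nat.succ_le_of_lt (rank_lt_rank hj h))]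
  · rw [if_neg h.not_ge, if_neg (by have := rank_le_rank m h.le; omega)]
    rfl

theorem lift_code {x : ℕ → ℝ} (hx : Function.Injective x) {k j : ℕ} (hj : j < k) (n : ℕ) :
    lift (code x) k (rank x k j) n = rank x (k + n) j := by
  induction n generalizing k with
  | zero => rfl
  | succ n ih =>
    rw [lift, ← rank_succ_eq_bump hx hj, ih (by omega)]
    congr 1
    omega

/-- The rank of `x j` starts as `code x j` and is then lifted by the codes of indices between `j`
and `m`; no other information enters. -/
theorem rank_congr {x y : ℕ → ℝ} (hx : Function.Injective x) (hy : Function.Injective y) {m : ℕ}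
    (h : ∀ k < m, code x k = code y k) {j : ℕ} (hj : j < m) : rank x m j = rank y m j := by
  obtain ⟨n, rfl⟩ := Nat.exists_eq_add_of_lt hj
  have key {z : ℕ → ℝ} (hz : Function.Injective z) :
      rank z (j + n + 1) j = lift (code z) (j + 1) (code z j) n := by
    rw [code, lift_code hz j.lt_succ_self]
    congr 1
    omega
  rw [key hx, key hy, h j hj]
  exact lift_congr _ fun i hi => h i (by omega)

/-- The relative frequencies of the sequence converge to the uniform distribution. -/
def IsEquidistributed (x : ℕ → ℝ) : Prop :=
  Function.Injective x ∧ (∀ j, x j ∈ Set.Ioo 0 1) ∧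
    ∀ j, Tendsto (fun m : ℕ => (rank x m j : ℝ) / m) atTop (𝓝 (x j))

theorem IsEquidistributed.freq_code {x : ℕ → ℝ} (hx : IsEquidistributed x) {k j : ℕ}
    (hj : j < k) : freq (code x) k (rank x k j) = ENNReal.ofReal (x j) := by
  refine Tendsto.limsup_eq ?_
  simp only [lift_code hx.1 hj]
  have h := (ENNReal.tendsto_ofReal (hx.2.2 j)).comp (tendsto_add_atTop_nat k)
  refine h.congr fun n => ?_
  simp only [Function.comp]
  rw [ENNReal.ofReal_div_of_pos (by exact_mod_cast (by omega : 0 < n + k)),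
    ENNReal.ofReal_natCast, ENNReal.ofReal_natCast, add_comm n k]

theorem IsEquidistributed.isProper {x : ℕ → ℝ} (hx : IsEquidistributed x) :
    IsProper (code x) := by
  intro k r hr
  rw [← image_rank hx.1, Finset.mem_image] at hr
  obtain ⟨j, hj, rfl⟩ := hr
  rw [hx.freq_code (Finset.mem_range.1 hj)]
  exact ⟨ENNReal.ofReal_pos.2 (hx.2.1 j).1, ENNReal.ofReal_lt_one.2 (hx.2.1 j).2⟩

/-- The positions of the `k` elements are the values `x 0, …, x (k - 1)` themselves, listed by rank;
the count does not see the order. -/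
theorem IsEquidistributed.vertex_code {x : ℕ → ℝ} (hx : IsEquidistributed x) (k : ℕ) :
    vertex c i₀ (code x) k = ∑ j ∈ Finset.range k, Finsupp.single (c (x j)) 1 := by
  rw [vertex, ← image_rank hx.1, Finset.sum_image (rank_injOn hx.1 k)]
  refine Finset.sum_congr rfl fun j hj => ?_
  rw [letter, if_pos hx.isProper, hx.freq_code (Finset.mem_range.1 hj),
    ENNReal.toReal_ofReal (hx.2.1 j).1.le]

end Pascal

/-! ### Comparison of laws of discrete sequences through their prefixes -/

theorem MeasureTheory.Measure.le_of_forall_singleton_le {α : Type*} [MeasurableSpace α]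
    [Countable α] [MeasurableSingletonClass α] {μ ν : Measure α} (h : ∀ a, μ {a} ≤ ν {a}) :
    μ ≤ ν := by
  refine Measure.le_iff.2 fun s hs => ?_
  rw [← lintegral_indicator_one hs, ← lintegral_indicator_one hs, lintegral_countable',
    lintegral_countable']
  exact ENNReal.tsum_le_tsum fun a => mul_le_mul_right (h a) _

/-- Two probability measures, one below the other, are equal. One-sided bounds on prefixes are
therefore enough, both for the law of the codes and for that of the walk. -/
theorem MeasureTheory.Measure.eq_of_forall_prefix_le {E : Type*} [MeasurableSpace E] [Countable E]
    [MeasurableSingletonClass E] (μ ν : Measure (ℕ → E)) [IsProbabilityMeasure μ]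
    [IsProbabilityMeasure ν]
    (h : ∀ (N : ℕ) (w : ℕ → E), μ {x | ∀ j < N, x j = w j} ≤ ν {x | ∀ j < N, x j = w j}) :
    μ = ν := by
  -- `x₀` only fills the irrelevant coordinates from `N` on.
  obtain ⟨x₀⟩ := nonempty_of_isProbabilityMeasure μ
  refine IsProjectiveLimit.unique (P := fun I => ν.map I.restrict) (fun I => ?_) fun I => rfl
  obtain ⟨N, hN⟩ := I.exists_nat_subset_range
  have hm : Measurable (Finset.restrict (π := fun _ => E) (Finset.range N)) :=
    Finset.measurable_restrict _
  have : IsProbabilityMeasure (μ.map (Finset.restrict (π := fun _ => E) (Finset.range N))) :=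
    Measure.isProbabilityMeasure_map hm.aemeasurable
  have : IsProbabilityMeasure (ν.map (Finset.restrict (π := fun _ => E) (Finset.range N))) :=
    Measure.isProbabilityMeasure_map hm.aemeasurable
  have key : μ.map (Finset.restrict (π := fun _ => E) (Finset.range N)) =
      ν.map (Finset.restrict (π := fun _ => E) (Finset.range N)) := by
    refine Measure.eq_of_le_of_isProbabilityMeasure
      (Measure.le_of_forall_singleton_le fun a => ?_)
    rw [Measure.map_apply hm (measurableSet_singleton a),
      Measure.map_apply hm (measurableSet_singleton a)]
    have : Finset.restrict (π := fun _ => E) (Finset.range N) ⁻¹' {a} = {x | ∀ j < N,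
        x j = (fun j => if hj : j ∈ Finset.range N then a ⟨j, hj⟩ else x₀ j) j} := by
      ext x
      simp only [Set.mem_preimage, Set.mem_singleton_iff, funext_iff, Subtype.forall]
      exact forall_congr' fun j => ⟨fun H hj => by
        simpa [hj] using H (Finset.mem_range.2 hj), fun H hj => by
        simpa [Finset.mem_range.1 hj] using H (Finset.mem_range.1 hj)⟩
    rw [this]
    exact h N _
  have hcomp : I.restrict (π := fun _ => E) = Finset.restrict₂ hN ∘ (Finset.range N).restrict :=
    rfl
  show μ.map I.restrict = ν.map I.restrict
  have h₂ : Measurable (Finset.restrict₂ (π := fun _ => E) hN) := Finset.measurable_restrict₂ hN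
  rw [hcomp, ← Measure.map_map h₂ hm, key, Measure.map_map h₂ hm]

/-! ### Independent uniform variables: equidistribution and law of the codes -/

namespace Pascal

open Filter Topology
open scoped ENNReal

/-- The uniform distribution on the unit interval. -/
noncomputable def unif : Measure ℝ := volume.restrict (Set.Ioo 0 1)

instance : IsProbabilityMeasure unif := ⟨by simp [unif]⟩

instance : NullSingletonClass unif := by unfold unif; infer_instance

theorem unif_real_Iic {q : ℝ} (hq : q ∈ Set.Ioo 0 1) : unif.real (Set.Iic q) = q := by
  rw [unif, measureReal_restrict_apply measurableSet_Iic]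
  have : Set.Iic q ∩ Set.Ioo 0 1 = Set.Ioc 0 q := by
    ext x
    simp only [Set.mem_inter_iff, Set.mem_Iic, Set.mem_Ioo, Set.mem_Ioc]
    have := hq.2
    constructor
    · exact fun h => ⟨h.2.1, h.1⟩
    · exact fun h => ⟨h.2, h.1, by linarith⟩
  rw [this, Real.volume_real_Ioc_of_le hq.1.le, sub_zero]

/-- The law of a sequence of independent uniform random variables. -/
noncomputable def iidUnif : Measure (ℕ → ℝ) := Measure.infinitePi fun _ => unif

instance : IsProbabilityMeasure iidUnif := by unfold iidUnif; infer_instance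

theorem map_eval_iidUnif (j : ℕ) : iidUnif.map (fun x => x j) = unif :=
  Measure.infinitePi_map_eval _ j

theorem iIndepFun_eval_iidUnif : iIndepFun (fun (j : ℕ) (x : ℕ → ℝ) => x j) iidUnif := by
  rw [iIndepFun_iff_map_fun_eq_infinitePi_map fun j => measurable_pi_apply j]
  simp only [map_eval_iidUnif]
  exact Measure.map_id

theorem ae_injective_iidUnif : ∀ᵐ x ∂iidUnif, Function.Injective x := by
  have key (i j : ℕ) (hij : i ≠ j) : ∀ᵐ x ∂iidUnif, x i ≠ x j := by
    have hind := iIndepFun_eval_iidUnif.indepFun hij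
    rw [indepFun_iff_map_prod_eq_prod_map_map (measurable_pi_apply i).aemeasurable
      (measurable_pi_apply j).aemeasurable, map_eval_iidUnif, map_eval_iidUnif] at hind
    have h0 : (unif.prod unif) (Set.diagonal ℝ) = 0 := by
      rw [Measure.prod_apply isClosed_diagonal.measurableSet]
      have (a : ℝ) : Prod.mk a ⁻¹' Set.diagonal ℝ = {a} := by
        ext b
        simp [eq_comm]
      simp [this, measure_singleton]
    rw [← hind, Measure.map_apply (by fun_prop) isClosed_diagonal.measurableSet] at h0
    exact measure_mono_null (fun x hx => by simpa using hx) h0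
  have h : ∀ᵐ x ∂iidUnif, ∀ i j, i ≠ j → x i ≠ x j :=
    ae_all_iff.2 fun i => ae_all_iff.2 fun j => by
      by_cases hij : i = j
      · simp [hij]
      · filter_upwards [key i j hij] with x hx _ using hx
  filter_upwards [h] with x hx i j hij
  by_contra hne
  exact hx i j hne hij

theorem ae_mem_Ioo_iidUnif : ∀ᵐ x ∂iidUnif, ∀ j, x j ∈ Set.Ioo (0 : ℝ) 1 := by
  refine ae_all_iff.2 fun j => ?_
  have h : ∀ᵐ y ∂unif, y ∈ Set.Ioo (0 : ℝ) 1 := ae_restrict_mem measurableSet_Ioo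
  rw [← map_eval_iidUnif j] at h
  exact ae_of_ae_map (measurable_pi_apply j).aemeasurable h

theorem ae_tendsto_frequency {q : ℝ} (hq : q ∈ Set.Ioo 0 1) : ∀ᵐ x ∂iidUnif,
    Tendsto (fun m : ℕ => (((Finset.range m).filter fun i => x i ≤ q).card : ℝ) / m)
      atTop (𝓝 q) := by
  have hF : Measurable ((Set.Iic q).indicator (1 : ℝ → ℝ)) :=
    measurable_one.indicator measurableSet_Iic
  have h := strong_law_ae_real (μ := iidUnif)
    (fun j x => (Set.Iic q).indicator (1 : ℝ → ℝ) (x j)) ?_ ?_ ?_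
  · have hE : ∫ x, (Set.Iic q).indicator (1 : ℝ → ℝ) (x 0) ∂iidUnif = q := by
      rw [← integral_map (φ := fun x : ℕ → ℝ => x 0) (measurable_pi_apply 0).aemeasurable
        hF.aestronglyMeasurable, map_eval_iidUnif, integral_indicator_one measurableSet_Iic,
        unif_real_Iic hq]
    rw [hE] at h
    filter_upwards [h] with x hx
    refine hx.congr fun m => ?_
    simp [Set.indicator_apply]
  · refine Integrable.of_bound (C := 1) (hF.comp (measurable_pi_apply 0)).aestronglyMeasurable
      (Eventually.of_forall fun x => ?_)
    by_cases h : x 0 ≤ q <;> simp [h]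
  · exact fun i j hij => (iIndepFun_eval_iidUnif.indepFun hij).comp hF hF
  · intro i
    refine IdentDistrib.comp (u := (Set.Iic q).indicator (1 : ℝ → ℝ))
      ⟨(measurable_pi_apply i).aemeasurable, (measurable_pi_apply 0).aemeasurable, ?_⟩ hF
    rw [map_eval_iidUnif, map_eval_iidUnif]

/-- The strong law holds simultaneously at all rational thresholds of the unit interval, and
monotonicity in the threshold squeezes the frequency at `x j` between rationals on either side. -/
theorem ae_isEquidistributed : ∀ᵐ x ∂iidUnif, IsEquidistributed x := by
  have h : ∀ᵐ x ∂iidUnif, ∀ q : ℚ, (q : ℝ) ∈ Set.Ioo (0 : ℝ) 1 →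
      Tendsto (fun m : ℕ => (((Finset.range m).filter fun i => x i ≤ (q : ℝ)).card : ℝ) / m)
        atTop (𝓝 (q : ℝ)) := by
    refine ae_all_iff.2 fun q => ?_
    by_cases hq : (q : ℝ) ∈ Set.Ioo (0 : ℝ) 1
    · filter_upwards [ae_tendsto_frequency hq] with x hx _ using hx
    · exact Eventually.of_forall fun x h => absurd h hq
  filter_upwards [h, ae_injective_iidUnif, ae_mem_Ioo_iidUnif] with x hx hinj h01
  refine ⟨hinj, h01, fun j => tendsto_order.2 ⟨fun a ha => ?_, fun a ha => ?_⟩⟩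
  -- The maximum with `0` here, and the minimum with `1` below, keep `q` in the unit interval.
  · obtain ⟨q, hq1, hq2⟩ := exists_rat_btwn (max_lt ha (h01 j).1)
    filter_upwards [(hx q ⟨(le_max_right _ _).trans_lt hq1, hq2.trans (h01 j).2⟩).eventually_const_lt
      ((le_max_left _ _).trans_lt hq1)] with m hm
    refine hm.trans_le ?_
    have : ((Finset.range m).filter fun i => x i ≤ (q : ℝ)).card ≤ rank x m j :=
      Finset.card_le_card fun i hi => by
        rw [Finset.mem_filter] at *
        exact ⟨hi.1, hi.2.trans hq2.le⟩
    gcongr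
  · obtain ⟨q, hq1, hq2⟩ := exists_rat_btwn (lt_min ha (h01 j).2)
    filter_upwards [(hx q ⟨(h01 j).1.trans hq1, hq2.trans_le (min_le_right _ _)⟩).eventually_lt_const
      (hq2.trans_le (min_le_left _ _))] with m hm
    refine LE.le.trans_lt ?_ hm
    have : rank x m j ≤ ((Finset.range m).filter fun i => x i ≤ (q : ℝ)).card :=
      Finset.card_le_card fun i hi => by
        rw [Finset.mem_filter] at *
        exact ⟨hi.1, hi.2.trans hq1.le⟩
    gcongr

theorem measurable_rank (m j : ℕ) : Measurable fun x => rank x m j := by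
  induction m with
  | zero => exact measurable_const
  | succ m ih =>
    simp only [rank_succ]
    exact ih.add (Measurable.ite
      (measurableSet_le (measurable_pi_apply m) (measurable_pi_apply j))
      measurable_const measurable_const)

theorem measurable_code (k : ℕ) : Measurable fun x => code x k := measurable_rank _ _

theorem measurePreserving_comp_perm (e : Equiv.Perm ℕ) :
    MeasurePreserving (fun (x : ℕ → ℝ) i => x (e i)) iidUnif iidUnif := by
  refine ⟨by fun_prop, ?_⟩
  have h := iIndepFun_eval_iidUnif.precomp e.injective
  rw [iIndepFun_iff_map_fun_eq_infinitePi_map fun j => measurable_pi_apply _] at h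
  simp only [map_eval_iidUnif] at h
  exact h

theorem rank_comp_perm (x : ℕ → ℝ) {m : ℕ} {e : Equiv.Perm ℕ} (he : ∀ i, e i < m ↔ i < m)
    (j : ℕ) : rank (fun i => x (e i)) m j = rank x m (e j) := by
  unfold rank
  refine Finset.card_bij (fun i _ => e i) ?_ ?_ ?_
  · intro i hi
    simpa [he] using hi
  · exact fun i _ j _ h => e.injective h
  · intro i hi
    refine ⟨e.symm i, ?_, by simp⟩
    have := he (e.symm i)
    simp only [Equiv.apply_symm_apply] at this
    simpa [← this] using hi

/-- Permuting the first `m` coordinates preserves the law. As `ρ` is injective below `m`, the `m!`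
permuted events are pairwise disjoint, and their equal masses sum to at most `1`. -/
theorem iidUnif_rank_le {m : ℕ} {ρ : ℕ → ℕ} (hρ : ∀ i < m, ∀ j < m, ρ i = ρ j → i = j) :
    iidUnif {x | ∀ j < m, rank x m j = ρ j} ≤ (m.factorial : ℝ≥0∞)⁻¹ := by
  set B : Set (ℕ → ℝ) := {x | ∀ j < m, rank x m j = ρ j}
  have hB : MeasurableSet B := by
    simp only [B, Set.ofPred_forall]
    exact MeasurableSet.iInter fun j => MeasurableSet.iInter fun _ =>
      measurable_rank m j (measurableSet_singleton _)
  -- Each permutation of the first `m` indices is extended by the identity.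
  let e (σ : Equiv.Perm (Fin m)) : Equiv.Perm ℕ := σ.extendDomain Fin.equivSubtype
  have he_apply (σ : Equiv.Perm (Fin m)) (j : Fin m) : e σ j = σ j :=
    Equiv.Perm.extendDomain_apply_image σ Fin.equivSubtype j
  have he (σ : Equiv.Perm (Fin m)) (i : ℕ) : e σ i < m ↔ i < m := by
    by_cases hi : i < m
    · have := he_apply σ ⟨i, hi⟩
      simp only at this
      simp [this, hi]
    · have : e σ i = i := Equiv.Perm.extendDomain_apply_not_subtype σ _ hi
      rw [this]
  let T (σ : Equiv.Perm (Fin m)) : Set (ℕ → ℝ) := (fun x i => x (e σ i)) ⁻¹' B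
  have hT (σ : Equiv.Perm (Fin m)) : iidUnif (T σ) = iidUnif B :=
    (measurePreserving_comp_perm (e σ)).measure_preimage hB.nullMeasurableSet
  have hmem {σ : Equiv.Perm (Fin m)} {x : ℕ → ℝ} (hx : x ∈ T σ) (j : Fin m) :
      rank x m (σ j) = ρ j := by
    rw [← he_apply, ← rank_comp_perm x (he σ)]
    exact hx j j.2
  have hdisj : Pairwise (Function.onFun Disjoint T) := by
    intro σ τ hne
    refine Set.disjoint_left.2 fun x hσ hτ => hne (Equiv.ext fun j => ?_)
    have h1 := hmem hσ (σ.symm (τ j))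
    rw [Equiv.apply_symm_apply, hmem hτ j] at h1
    have h2 := Fin.ext (hρ _ j.2 _ (σ.symm (τ j)).2 h1)
    rw [Equiv.eq_symm_apply] at h2
    exact h2
  have hsum : ∑ σ : Equiv.Perm (Fin m), iidUnif (T σ) ≤ 1 := by
    rw [← tsum_fintype (L := .unconditional _), ← measure_iUnion hdisj fun σ =>
      (measurePreserving_comp_perm (e σ)).measurable hB]
    exact prob_le_one
  simp only [hT, Finset.sum_const, Finset.card_univ, Fintype.card_perm, Fintype.card_fin,
    nsmul_eq_mul] at hsum
  rw [ENNReal.le_inv_iff_mul_le, mul_comm]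
  exact hsum

/-- Almost surely the sequence is injective, so the codes determine the ranks; a code prefix
realized by no injective sequence is null. -/
theorem iidUnif_code_le (m : ℕ) (u : ℕ → ℕ) :
    iidUnif {x | ∀ j < m, code x j = u j} ≤ (m.factorial : ℝ≥0∞)⁻¹ := by
  by_cases h : ∃ y : ℕ → ℝ, Function.Injective y ∧ ∀ j < m, code y j = u j
  · obtain ⟨y, hy, hu⟩ := h
    refine le_trans (measure_mono_ae ?_) (iidUnif_rank_le (m := m) (ρ := rank y m)
      fun i hi j hj hij => rank_injOn hy m (by simpa using hi) (by simpa using hj) hij)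
    filter_upwards [ae_injective_iidUnif] with x hx h j hj
    exact rank_congr hx hy (fun k hk => (h k hk).trans (hu k hk).symm) hj
  · refine le_trans (le_of_eq ?_) zero_le
    refine measure_mono_null (t := {x | ¬ Function.Injective x}) (fun x hx hinj => ?_)
      ae_injective_iidUnif
    exact h ⟨x, hinj, hx⟩

instance (k : ℕ) : IsProbabilityMeasure (uniformOn (Set.Icc 1 (k + 1))) :=
  isProbabilityMeasure_uniformOn (Set.finite_Icc _ _) ⟨1, by simp⟩

theorem uniformOn_Icc_singleton {k u : ℕ} (hu : u ∈ Set.Icc 1 (k + 1)) :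
    uniformOn (Set.Icc 1 (k + 1)) {u} = ((k + 1 : ℕ) : ℝ≥0∞)⁻¹ := by
  rw [uniformOn, cond_apply measurableSet_Icc, Set.inter_eq_right.2 (by simpa using hu),
    Measure.count_singleton, mul_one, ← Finset.coe_Icc, Measure.count_apply_finset,
    Nat.card_Icc, Nat.add_sub_cancel]

theorem map_code : iidUnif.map (fun x k => code x k) =
    Measure.infinitePi fun k => uniformOn (Set.Icc 1 (k + 1)) := by
  have hm : Measurable fun (x : ℕ → ℝ) k => code x k := measurable_pi_lambda _ measurable_code
  have := Measure.isProbabilityMeasure_map (μ := iidUnif) hm.aemeasurable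
  refine Measure.eq_of_forall_prefix_le _ _ fun N u => ?_
  have hset : {x : ℕ → ℕ | ∀ j < N, x j = u j} = Set.pi (Finset.range N) fun j => {u j} := by
    ext x
    simp
  rw [Measure.map_apply hm (by
    rw [hset]
    exact MeasurableSet.pi (Finset.range N).countable_toSet
      fun j _ => measurableSet_singleton _), Set.preimage_ofPred_eq]
  -- On admissible prefixes the product of uniform masses is exactly `1 / N!`, which matches the
  -- upper bound; other prefixes are never produced by codes.
  by_cases hu : ∀ j < N, u j ∈ Set.Icc 1 (j + 1)
  · refine (iidUnif_code_le N u).trans_eq ?_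
    rw [hset, Measure.infinitePi_pi _ fun j _ => measurableSet_singleton _,
      Finset.prod_congr rfl fun j hj => uniformOn_Icc_singleton (hu j (Finset.mem_range.1 hj)),
      ← ENNReal.prod_inv_distrib, ← Finset.prod_range_add_one_eq_factorial]
    · push_cast
      rfl
    · exact fun i _ j _ _ => .inl (by simp)
  · refine le_trans (le_of_eq ?_) zero_le
    convert measure_empty (μ := iidUnif)
    refine Set.eq_empty_of_forall_notMem fun x hx => hu fun j hj => ?_
    rw [← hx j hj]
    simpa using code_mem_Icc x j

theorem map_code_apply (k : ℕ) :
    iidUnif.map (fun x => code x k) = uniformOn (Set.Icc 1 (k + 1)) := by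
  have hm : Measurable fun (x : ℕ → ℝ) k => code x k := measurable_pi_lambda _ measurable_code
  have h := Measure.infinitePi_map_eval (fun k : ℕ => uniformOn (Set.Icc 1 (k + 1))) k
  rw [← map_code, Measure.map_map (measurable_pi_apply k) hm] at h
  exact h

theorem iIndepFun_code : iIndepFun (fun (k : ℕ) (x : ℕ → ℝ) => code x k) iidUnif := by
  rw [iIndepFun_iff_map_fun_eq_infinitePi_map measurable_code, map_code]
  simp only [map_code_apply]

end Pascal

/-! ### Conditional independence produced by an independent innovation -/

section Immersion

variable {Ω : Type*}

theorem MeasurableSpace.isPiSystem_inter (m₁ m₂ : MeasurableSpace Ω) :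
    IsPiSystem {s | ∃ A B, MeasurableSet[m₁] A ∧ MeasurableSet[m₂] B ∧ s = A ∩ B} := by
  rintro _ ⟨A, B, hA, hB, rfl⟩ _ ⟨A', B', hA', hB', rfl⟩ _
  exact ⟨A ∩ A', B ∩ B', hA.inter hA', hB.inter hB', Set.inter_inter_inter_comm _ _ _ _⟩

theorem MeasurableSpace.sup_eq_generateFrom_inter (m₁ m₂ : MeasurableSpace Ω) :
    m₁ ⊔ m₂ =
      generateFrom {s | ∃ A B, MeasurableSet[m₁] A ∧ MeasurableSet[m₂] B ∧ s = A ∩ B} := by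
  refine le_antisymm (sup_le (fun A hA => ?_) fun B hB => ?_) (generateFrom_le ?_)
  · exact measurableSet_generateFrom ⟨A, Set.univ, hA, .univ, (Set.inter_univ A).symm⟩
  · exact measurableSet_generateFrom ⟨Set.univ, B, .univ, hB, (Set.univ_inter B).symm⟩
  · rintro _ ⟨A, B, hA, hB, rfl⟩
    exact ((le_sup_left : m₁ ≤ m₁ ⊔ m₂) A hA).inter ((le_sup_right : m₂ ≤ m₁ ⊔ m₂) B hB)

/-- Conditioning first on `mG` turns `C` into the constant `μ.real C`; the tower property then
brings the rest down to `mF`, where `A` factors out. -/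
theorem ProbabilityTheory.condExp_indicator_inter_of_indep {mF mG mU mΩ : MeasurableSpace Ω}
    {μ : Measure Ω} [IsProbabilityMeasure μ] (hFG : mF ≤ mG) (hG : mG ≤ mΩ) (hU : mU ≤ mΩ)
    (hind : Indep mU mG μ) {A C B : Set Ω} (hA : MeasurableSet[mF] A) (hC : MeasurableSet[mU] C)
    (hB : MeasurableSet[mG] B) :
    μ[((A ∩ C) ∩ B).indicator (fun _ => (1 : ℝ)) | mF] =ᵐ[μ]
      A.indicator fun ω => μ.real C * (μ[B.indicator (fun _ => (1 : ℝ)) | mF]) ω := by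
  have hF : mF ≤ mΩ := hFG.trans hG
  have hint {s : Set Ω} (hs : MeasurableSet s) :
      Integrable (s.indicator fun _ => (1 : ℝ)) μ := (integrable_const 1).indicator hs
  have h1 : μ[(B ∩ C).indicator (fun _ => (1 : ℝ)) | mG] =ᵐ[μ]
      μ.real C • B.indicator fun _ => (1 : ℝ) := by
    rw [← Set.indicator_indicator]
    have h := condExp_indep_eq hU hG (f := C.indicator fun _ => (1 : ℝ))
      (stronglyMeasurable_const.indicator hC) hind
    filter_upwards [condExp_indicator (hint (hU _ hC)) hB, h] with ω hω h'
    rw [hω]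
    by_cases hωB : ω ∈ B
    · simp [hωB, h', integral_indicator (hU _ hC), Measure.real]
    · simp [hωB]
  have h2 : μ[(B ∩ C).indicator (fun _ => (1 : ℝ)) | mF] =ᵐ[μ]
      μ.real C • μ[B.indicator (fun _ => (1 : ℝ)) | mF] :=
    ((condExp_condExp_of_le hFG hG).symm.trans (condExp_congr_ae h1)).trans
      (condExp_smul _ _ _)
  have h3 : (A ∩ C) ∩ B = A ∩ (B ∩ C) := by
    rw [Set.inter_assoc, Set.inter_comm C]
  rw [h3, ← Set.indicator_indicator]
  refine (condExp_indicator (hint ((hG _ hB).inter (hU _ hC))) hA).trans ?_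
  filter_upwards [h2] with ω hω
  by_cases hωA : ω ∈ A
  · simp [hωA, hω]
  · simp [hωA]

/-- Sets `A ∩ C` form a π-system generating `mF ⊔ mU`; on it the factorization follows from the
previous formula, applied to `B` and to the whole space. -/
theorem ProbabilityTheory.condIndep_sup_of_indep {mF mG mU mΩ : MeasurableSpace Ω}
    [StandardBorelSpace Ω] {μ : Measure Ω} [IsProbabilityMeasure μ] (hFG : mF ≤ mG)
    (hG : mG ≤ mΩ) (hU : mU ≤ mΩ) (hind : Indep mU mG μ) :
    CondIndep mF (mF ⊔ mU) mG (hFG.trans hG) μ := by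
  have hF : mF ≤ mΩ := hFG.trans hG
  refine CondIndepSets.condIndep (sup_le hF hU) hG (MeasurableSpace.isPiSystem_inter mF mU)
    (@MeasurableSpace.isPiSystem_measurableSet _ mG) (MeasurableSpace.sup_eq_generateFrom_inter _ _)
    (@MeasurableSpace.generateFrom_measurableSet _ mG).symm ?_
  refine (condIndepSets_iff _ _ _ _ ?_ (fun B hB => hG B hB) _).2 ?_
  · rintro _ ⟨A, C, hA, hC, rfl⟩
    exact (hF A hA).inter (hU C hC)
  · rintro _ B ⟨A, C, hA, hC, rfl⟩ hB
    have h1 := condExp_indicator_inter_of_indep hFG hG hU hind hA hC hB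
    have h2 := condExp_indicator_inter_of_indep hFG hG hU hind hA hC .univ
    rw [Set.inter_univ] at h2
    filter_upwards [h1, h2] with ω h1 h2
    rw [Pi.mul_apply, h1, h2]
    by_cases hωA : ω ∈ A
    · simp [hωA, condExp_const hF]
    · simp [hωA]

end Immersion

/-- A finite sum of a constant over an infinite type forces the constant to be `0`. Covering that
case allows cancelling the number of paths to a vertex without showing it finite. -/
theorem ENNReal.eq_of_tsum_const_eq {ι : Type*} [Nonempty ι] {a b : ENNReal}
    (h : ∑' _ : ι, a = ∑' _ : ι, b) (ha : ∑' _ : ι, a ≠ ⊤) : a = b := by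
  rcases finite_or_infinite ι with hι | hι
  · have := Fintype.ofFinite ι
    rw [tsum_fintype, tsum_fintype, Finset.sum_const, Finset.sum_const, nsmul_eq_mul,
      nsmul_eq_mul] at h
    exact (ENNReal.mul_right_inj (by simp) (by simp)).1 h
  · have key {c : ENNReal} (hc : ∑' _ : ι, c ≠ ⊤) : c = 0 := by
      by_contra hne
      exact hc (ENNReal.tsum_const_eq_top_of_ne_zero hne)
    exact (key ha).trans (key (h ▸ ha)).symm

/-! ### Quantile coding of `θ` and the law of the walk -/

namespace Pascal

open Filter Topology
open scoped ENNReal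

variable {d : ℕ∞} {θ : Coord d → ℝ}

theorem exists_quantile (hθ : IsProbVector θ) : ∃ c : ℝ → Coord d, Measurable c ∧
    MonotoneOn c (Set.Ioo 0 1) ∧ ∀ i, unif (c ⁻¹' {i}) = ENNReal.ofReal (θ i) := by
  classical
  -- Extension by zero beyond `d` treats finite and infinite dimension together; no point of the
  -- interval falls in a step of zero width, so the index found below is a genuine coordinate.
  set t : ℕ → ℝ := Function.extend Subtype.val θ 0
  have ht_val (i : Coord d) : t i = θ i := Subtype.val_injective.extend_apply _ _ _
  have ht_nonneg (n : ℕ) : 0 ≤ t n := by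
    by_cases h : (n : ℕ∞) < d
    · exact (ht_val ⟨n, h⟩).symm ▸ hθ.1 _
    · exact (Function.extend_apply' θ (0 : ℕ → ℝ) n fun ⟨i, hi⟩ => h (hi ▸ i.2)).ge
  set S : ℕ → ℝ := fun n => ∑ j ∈ Finset.range n, t j
  have hS_succ (n : ℕ) : S (n + 1) = S n + t n := Finset.sum_range_succ _ _
  have hS_mono : Monotone S := monotone_nat_of_le_succ fun n => by
    rw [hS_succ]; linarith [ht_nonneg n]
  have hS_zero : S 0 = 0 := Finset.sum_range_zero _
  have hsum : HasSum t 1 := (hasSum_extend_zero Subtype.val_injective).2 hθ.2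
  have hS_lim : Tendsto S atTop (𝓝 1) := hsum.tendsto_sum_nat
  have hS_le (n : ℕ) : S n ≤ 1 := hS_mono.ge_of_tendsto hS_lim n
  have hex (x : ℝ) (hx : x ∈ Set.Ioo (0 : ℝ) 1) : ∃ i : Coord d, S i < x ∧ x ≤ S (i + 1) := by
    have h : ∃ n, x ≤ S n := (hS_lim.eventually_const_lt hx.2).exists.imp fun _ h => h.le
    obtain ⟨n, hn⟩ : ∃ n, Nat.find h = n + 1 := Nat.exists_eq_succ_of_ne_zero fun h0 => by
      have := Nat.find_spec h
      rw [h0, hS_zero] at this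
      exact hx.1.not_ge this
    have h1 : x ≤ S (n + 1) := hn ▸ Nat.find_spec h
    have h2 : S n < x := not_le.1 (Nat.find_min h (by omega))
    have hnd : (n : ℕ∞) < d := by
      by_contra hnd
      have : t n = 0 := Function.extend_apply' θ (0 : ℕ → ℝ) n fun ⟨i, hi⟩ => hnd (hi ▸ i.2)
      rw [hS_succ, this, add_zero] at h1
      exact h1.not_gt h2
    exact ⟨⟨n, hnd⟩, h2, h1⟩
  obtain ⟨i₀, -⟩ := hex (1 / 2) (by norm_num)
  have : Nonempty (Coord d) := ⟨i₀⟩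
  choose! f hf using hex
  have hf_iff {x : ℝ} (hx : x ∈ Set.Ioo (0 : ℝ) 1) (i : Coord d) :
      f x = i ↔ S i < x ∧ x ≤ S (i + 1) := by
    refine ⟨fun h => h ▸ hf x hx, fun h => ?_⟩
    have key {i j : Coord d} (h1 : S i < x) (h2 : x ≤ S (j + 1)) : i ≤ j := by
      by_contra! hlt
      exact (h1.trans_le h2).not_ge (hS_mono (Nat.succ_le_of_lt hlt))
    exact le_antisymm (key (hf x hx).1 h.2) (key h.1 (hf x hx).2)
  let c : ℝ → Coord d := fun x => if x ∈ Set.Ioo (0 : ℝ) 1 then f x else i₀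
  have hc {x : ℝ} (hx : x ∈ Set.Ioo (0 : ℝ) 1) : c x = f x := if_pos hx
  refine ⟨c, measurable_to_countable' fun i => ?_, fun x hx y hy hxy => ?_, fun i => ?_⟩
  · have : c ⁻¹' {i} = (Set.Ioo 0 1 ∩ Set.Ioc (S i) (S (i + 1))) ∪
        ((Set.Ioo 0 1)ᶜ ∩ {_x | i₀ = i}) := by
      ext x
      by_cases hx : x ∈ Set.Ioo (0 : ℝ) 1
      · simp only [Set.mem_preimage, Set.mem_singleton_iff, hc hx, hf_iff hx, Set.mem_union,
          Set.mem_inter_iff, hx, Set.mem_compl_iff, not_true, false_and, or_false, true_and,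
          Set.mem_Ioc]
      · simp only [Set.mem_preimage, Set.mem_singleton_iff, c, if_false, Set.mem_union,
          Set.mem_inter_iff, hx, Set.mem_compl_iff, not_false_eq_true, false_and, false_or,
          true_and, Set.mem_ofPred_eq]
    rw [this]
    exact (measurableSet_Ioo.inter measurableSet_Ioc).union
      (measurableSet_Ioo.compl.inter (MeasurableSet.const _))
  · rw [hc hx, hc hy]
    by_contra! hlt
    have h1 := (hf x hx).1
    have h2 := (hf y hy).2
    have h3 := hS_mono (Nat.succ_le_of_lt hlt)
    simp only [Nat.succ_eq_add_one] at h3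
    linarith
  · have h0 : 0 ≤ S i := hS_zero ▸ hS_mono (Nat.zero_le _)
    have h1 := hS_le (i + 1)
    have hvol : ENNReal.ofReal (S (i + 1) - S i) = ENNReal.ofReal (θ i) := by
      rw [hS_succ, ht_val, add_sub_cancel_left]
    have hset : c ⁻¹' {i} ∩ Set.Ioo 0 1 = Set.Ioo 0 1 ∩ Set.Ioc (S i) (S (i + 1)) := by
      ext x
      by_cases hx : x ∈ Set.Ioo (0 : ℝ) 1
      · simp only [Set.mem_inter_iff, Set.mem_preimage, Set.mem_singleton_iff, hc hx, hf_iff hx,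
          hx, Set.mem_Ioc, and_true, true_and]
      · simp only [Set.mem_inter_iff, hx, and_false, false_and]
    rw [unif, Measure.restrict_apply' measurableSet_Ioo, hset, ← hvol]
    refine le_antisymm ?_ ?_
    · rw [← Real.volume_Ioc]
      exact measure_mono Set.inter_subset_right
    · rw [← Real.volume_Ioo]
      exact measure_mono fun x hx =>
        ⟨⟨h0.trans_lt hx.1, hx.2.trans_le h1⟩, hx.1, hx.2.le⟩

theorem exists_steps (γ : Path d) : ∃ s : ℕ → Coord d,
    ∀ k, walk d k γ = ∑ j ∈ Finset.range k, Finsupp.single (s j) 1 := by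
  choose s hs using fun k => exists_eq_add_single (γ.2.1 k) (γ.2.1 (k + 1)) (γ.2.2 k)
  refine ⟨s, fun k => ?_⟩
  induction k with
  | zero =>
    have h := γ.2.1 0
    rw [mem_level_iff, Finsupp.degree_eq_zero_iff] at h
    exact h
  | succ k ih =>
    rw [Finset.sum_range_succ, ← ih]
    exact hs k

/-- The path segment between the levels `0` and `-k`. -/
def segment (d : ℕ∞) (k : ℕ) (γ : Path d) : Fin (k + 1) → Vertex d := fun j => walk d j γ

theorem measurable_segment (d : ℕ∞) (k : ℕ) : Measurable (segment d k) :=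
  measurable_pi_lambda _ fun j => measurable_walk d j

theorem isFinitePath_segment (k : ℕ) (γ : Path d) : IsFinitePath (segment d k γ) :=
  ⟨fun j => γ.2.1 j, fun j => γ.2.2 j⟩

theorem IsFinitePath.snoc {k : ℕ} {w : Fin (k + 1) → Vertex d} (hw : IsFinitePath w)
    {v : Vertex d} (hv : v ∈ level d (k + 1)) (h : Adj (w (Fin.last k)) v) :
    IsFinitePath (Fin.snoc (α := fun _ => Vertex d) w v : Fin (k + 1 + 1) → Vertex d) := by
  refine ⟨fun j => ?_, fun j => ?_⟩
  · induction j using Fin.lastCases with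
    | last => simpa using hv
    | cast j => simpa using hw.1 j
  · induction j using Fin.lastCases with
    | last => simpa using h
    | cast j =>
      rw [Fin.succ_castSucc, Fin.snoc_castSucc, Fin.snoc_castSucc]
      exact hw.2 j

variable {μ : Measure (Path d)} [IsProbabilityMeasure μ]

/-- Integrating the centrality identity gives the mass of `w` as an expression involving only its
last vertex. -/
theorem IsCentral.measure_segment_eq (hμ : IsCentral μ) {k : ℕ} {w w' : Fin (k + 1) → Vertex d}
    (hw : IsFinitePath w) (hw' : IsFinitePath w') (h : w (Fin.last k) = w' (Fin.last k)) :
    μ (segment d k ⁻¹' {w}) = μ (segment d k ⁻¹' {w'}) := by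
  have hset (w : Fin (k + 1) → Vertex d) :
      {γ : Path d | ∀ j : Fin (k + 1), walk d j γ = w j} = segment d k ⁻¹' {w} := by
    ext γ
    simp [segment, funext_iff]
  have key {w : Fin (k + 1) → Vertex d} (hw : IsFinitePath w) :
      μ.real (segment d k ⁻¹' {w}) = ∫ γ, {γ : Path d | walk d k γ = w (Fin.last k)}.indicator
        (fun γ => 1 / (dim k (walk d k γ) : ℝ)) γ ∂μ := by
    rw [← integral_congr_ae (hμ k w hw), integral_condExp ((filtration d).le _), hset,
      integral_indicator (measurable_segment d k (measurableSet_singleton w))]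
    simp
  rw [← measureReal_eq_measureReal_iff, key hw, key hw', h]

theorem IsMultinomialCentral.measure_inter (hμ : IsMultinomialCentral θ μ) (k : ℕ) (v : Vertex d)
    (i : Coord d) : μ ({γ | walk d (k + 1) γ = v + Finsupp.single i 1} ∩ {γ | walk d k γ = v}) =
      ENNReal.ofReal (θ i) * μ {γ | walk d k γ = v} := by
  by_cases h0 : μ {γ | walk d k γ = v} = 0
  · rw [h0, mul_zero]
    exact measure_mono_null Set.inter_subset_right h0
  · have hv : MeasurableSet {γ : Path d | walk d k γ = v} :=
      measurable_walk d k (measurableSet_singleton v)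
    rw [← hμ.2 k v i h0, ofReal_measureReal, cond_apply hv, mul_right_comm, ENNReal.inv_mul_cancel h0
      (measure_ne_top _ _), one_mul, Set.inter_comm]

/-- By centrality, all paths from the root to the current vertex have equal mass, and so do their
extensions by the given edge. Summing over these paths reduces the claim to the transition
probability, and the common number of terms cancels. -/
theorem IsMultinomialCentral.measure_segment_succ (hμ : IsMultinomialCentral θ μ) (k : ℕ)
    {γ : Path d} {i : Coord d} (hi : walk d (k + 1) γ = walk d k γ + Finsupp.single i 1) :
    μ (segment d (k + 1) ⁻¹' {segment d (k + 1) γ}) =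
      ENNReal.ofReal (θ i) * μ (segment d k ⁻¹' {segment d k γ}) := by
  set S : Set (Fin (k + 1) → Vertex d) := {w | IsFinitePath w ∧ w (Fin.last k) = walk d k γ}
  have hγ : segment d k γ ∈ S := ⟨isFinitePath_segment k γ, rfl⟩
  have : Nonempty S := ⟨⟨_, hγ⟩⟩
  have hS : segment d k ⁻¹' S = {γ' | walk d k γ' = walk d k γ} := by
    ext γ'
    exact ⟨fun h => h.2, fun h => ⟨isFinitePath_segment k γ', h⟩⟩
  set B : Set (Path d) := {γ' | walk d (k + 1) γ' = walk d k γ + Finsupp.single i 1}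
  have hmeas (w : Fin (k + 1) → Vertex d) : MeasurableSet (segment d k ⁻¹' {w}) :=
    measurable_segment d k (measurableSet_singleton w)
  have h1 : ∑' _ : S, μ (segment d k ⁻¹' {segment d k γ}) = μ {γ' | walk d k γ' = walk d k γ} := by
    rw [← hS, ← tsum_measure_preimage_singleton S.to_countable fun w _ => hmeas w]
    exact tsum_congr fun w => hμ.1.measure_segment_eq hγ.1 w.2.1 w.2.2.symm
  have h2 : ∑' _ : S, μ (segment d (k + 1) ⁻¹' {segment d (k + 1) γ}) =
      μ (B ∩ {γ' | walk d k γ' = walk d k γ}) := by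
    have hB : MeasurableSet B := measurable_walk d (k + 1) (measurableSet_singleton _)
    rw [Set.inter_comm, ← Measure.restrict_apply' hB, ← hS,
      ← tsum_measure_preimage_singleton S.to_countable fun w _ => hmeas w]
    refine tsum_congr fun w => ?_
    have hpath : IsFinitePath
        (Fin.snoc (α := fun _ => Vertex d) w.1 (walk d (k + 1) γ) : Fin (k + 1 + 1) → Vertex d) :=
      w.2.1.snoc (γ.2.1 (k + 1)) (by rw [w.2.2]; exact γ.2.2 k)
    rw [Measure.restrict_apply' hB, hμ.1.measure_segment_eq (isFinitePath_segment (k + 1) γ) hpath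
      (by simp [segment])]
    congr 1
    ext γ'
    simp only [Set.mem_preimage, Set.mem_singleton_iff, Set.mem_inter_iff, funext_iff,
      Fin.forall_fin_succ', Fin.snoc_castSucc, Fin.snoc_last, B, Set.mem_ofPred_eq, ← hi]
    rfl
  refine ENNReal.eq_of_tsum_const_eq (ι := S) ?_ ?_
  · rw [h2, ENNReal.tsum_mul_left, h1, hμ.measure_inter]
  · rw [h2]
    exact measure_ne_top _ _

theorem IsMultinomialCentral.measure_segment_le (hμ : IsMultinomialCentral θ μ) (γ : Path d)
    {s : ℕ → Coord d} (hs : ∀ k, walk d k γ = ∑ j ∈ Finset.range k, Finsupp.single (s j) 1)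
    (k : ℕ) : μ (segment d k ⁻¹' {segment d k γ}) ≤
      ∏ j ∈ Finset.range k, ENNReal.ofReal (θ (s j)) := by
  induction k with
  | zero => simpa using prob_le_one
  | succ k ih =>
    rw [Finset.prod_range_succ, mul_comm, hμ.measure_segment_succ k (i := s k) (by
      rw [hs, hs, Finset.sum_range_succ])]
    gcongr

variable {c : ℝ → Coord d}

/-- The event that `c (x j) = s j` for all `j < k` has exactly the product as its mass, and almost
surely it forces the vertices. -/
theorem iidUnif_vertex_ge (i₀ : Coord d)
    (hc : Measurable c) (hcθ : ∀ i, unif (c ⁻¹' {i}) = ENNReal.ofReal (θ i)) (s : ℕ → Coord d)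
    (k : ℕ) : ∏ j ∈ Finset.range k, ENNReal.ofReal (θ (s j)) ≤
      iidUnif {x | ∀ j ≤ k,
        vertex c i₀ (code x) j = ∑ l ∈ Finset.range j, Finsupp.single (s l) 1} := by
  have h : iidUnif (Set.pi (Finset.range k) fun j => c ⁻¹' {s j}) =
      ∏ j ∈ Finset.range k, ENNReal.ofReal (θ (s j)) := by
    rw [iidUnif, Measure.infinitePi_pi _ fun j _ => hc (measurableSet_singleton _)]
    simp only [hcθ]
  rw [← h]
  refine measure_mono_ae ?_
  filter_upwards [ae_isEquidistributed] with x hx hxs j hj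
  rw [hx.vertex_code]
  refine Finset.sum_congr rfl fun l hl => ?_
  have : c (x l) = s l := hxs l (by simpa using (Finset.mem_range.1 hl).trans_le hj)
  rw [this]

theorem measurable_vertex_code (i₀ : Coord d) (hc : Measurable c) (k : ℕ) :
    Measurable fun x => vertex c i₀ (code x) k :=
  measurable_vertex i₀ hc (U := fun k x => code x k) fun j _ => measurable_code j

/-- For each prefix that a path can realize, the product of the `θ i` along its steps lies between
its mass under `μ` and its mass under the construction; any other prefix is null under `μ`. -/
theorem IsMultinomialCentral.map_walk (hμ : IsMultinomialCentral θ μ) (i₀ : Coord d)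
    (hc : Measurable c) (hcθ : ∀ i, unif (c ⁻¹' {i}) = ENNReal.ofReal (θ i)) :
    μ.map (fun γ k => walk d k γ) = iidUnif.map fun x k => vertex c i₀ (code x) k := by
  have hm : Measurable fun (γ : Path d) k => walk d k γ := measurable_pi_lambda _ (measurable_walk d)
  have hm' : Measurable fun (x : ℕ → ℝ) k => vertex c i₀ (code x) k :=
    measurable_pi_lambda _ (measurable_vertex_code i₀ hc)
  have := Measure.isProbabilityMeasure_map (μ := μ) hm.aemeasurable
  have := Measure.isProbabilityMeasure_map (μ := iidUnif) hm'.aemeasurable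
  refine Measure.eq_of_forall_prefix_le _ _ fun N w => ?_
  have hset : MeasurableSet {x : ℕ → Vertex d | ∀ j < N, x j = w j} := by
    simp only [Set.ofPred_forall]
    exact MeasurableSet.iInter fun j => MeasurableSet.iInter fun _ =>
      measurable_pi_apply j (measurableSet_singleton _)
  rw [Measure.map_apply hm hset, Measure.map_apply hm' hset, Set.preimage_ofPred_eq,
    Set.preimage_ofPred_eq]
  by_cases hw : ∃ γ : Path d, ∀ j < N, walk d j γ = w j
  · obtain ⟨γ, hγ⟩ := hw
    obtain ⟨s, hs⟩ := exists_steps γ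
    cases N with
    | zero => simp
    -- A prefix of `k + 1` vertices consists of `k` steps.
    | succ k =>
      refine le_trans ?_ ((hμ.measure_segment_le γ hs k).trans
        ((iidUnif_vertex_ge i₀ hc hcθ s k).trans ?_))
      · refine measure_mono fun γ' h => funext fun j => ?_
        exact (h j j.2).trans (hγ j j.2).symm
      · refine measure_mono fun x h j hj => ?_
        exact (h j (Nat.lt_succ_iff.1 hj)).trans ((hs j).symm.trans (hγ j hj))
  · refine le_trans (le_of_eq ?_) zero_le
    convert measure_empty (μ := μ)
    exact Set.eq_empty_of_forall_notMem fun γ h => hw ⟨γ, h⟩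

end Pascal

/-! ### Generating parameterizations, immersion and the zero-one law -/

section Filtrations

universe u

variable {Ω : Type u} {mΩ : MeasurableSpace Ω} {E S : ℕ → Type u} [∀ k, MeasurableSpace (E k)]
  [∀ k, MeasurableSpace (S k)]

theorem measurable_generatedFiltration {X : ∀ k, Ω → E k} (hX : ∀ k, Measurable (X k)) {j k : ℕ}
    (h : k ≤ j) : Measurable[generatedFiltration X hX (toDual k)] (X j) :=
  measurable_iff_comap_le.2 (le_iSup₂_of_le j h le_rfl)

theorem generatedFiltration_le_iff {X : ∀ k, Ω → E k} (hX : ∀ k, Measurable (X k)) {k : ℕ}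
    {m : MeasurableSpace Ω} :
    generatedFiltration X hX (toDual k) ≤ m ↔ ∀ j, k ≤ j → Measurable[m] (X j) := by
  simp only [measurable_iff_comap_le]
  exact iSup₂_le_iff

theorem indep_generatedFiltration_succ {U : ∀ k, Ω → S k} (hU : ∀ k, Measurable (U k))
    {μ : Measure Ω} (hind : iIndepFun U μ) (k : ℕ) :
    Indep (MeasurableSpace.comap (U k) inferInstance)
      (generatedFiltration U hU (toDual (k + 1))) μ := by
  have h := indep_iSup_of_disjoint (fun j => (hU j).comap_le) hind
    (S := {k}) (T := Set.Ici (k + 1)) (by simp)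
  rw [iSup_singleton] at h
  exact h

theorem isKolmogorovian_generatedFiltration {U : ∀ k, Ω → S k} (hU : ∀ k, Measurable (U k))
    {μ : Measure Ω} (hind : iIndepFun U μ) : IsKolmogorovian (generatedFiltration U hU) μ := by
  intro A hA
  refine measure_zero_or_one_of_measurableSet_limsup_atTop (fun k => (hU k).comap_le) hind ?_
  rw [Filter.limsup_eq_iInf_iSup_of_nat]
  exact hA

/-- If `X` is obtained recursively from an independent sequence `U` generating it, then `U` is a
generating parameterization. -/
theorem isGeneratingParameterization_of_recursion {X : ∀ k, Ω → E k} (hX : ∀ k, Measurable (X k))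
    {U : ∀ k, Ω → S k} (hU : ∀ k, Measurable (U k)) {μ : Measure Ω} (hind : iIndepFun U μ)
    (hadapted : ∀ k, Measurable[generatedFiltration U hU (toDual k)] (X k))
    {f : ∀ k, E (k + 1) × S k → E k} (hf : ∀ k, Measurable (f k))
    (hrec : ∀ k, X k = fun ω => f k (X (k + 1) ω, U k ω)) :
    IsGeneratingParameterization (generatedFiltration X hX) U hU μ := by
  have hle : generatedFiltration X hX ≤ generatedFiltration U hU := fun k =>
    (generatedFiltration_le_iff hX).2 fun j hj =>
      (hadapted j).mono ((generatedFiltration U hU).mono (toDual_le_toDual.2 hj)) le_rfl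
  refine ⟨fun k => ⟨?_, ?_⟩, hle⟩
  · rw [sup_eq_right.2 (hle _)]
    exact indep_generatedFiltration_succ hU hind k
  · refine (generatedFiltration_le_iff hX).2 fun j hj => ?_
    rcases hj.eq_or_lt with rfl | hj
    · rw [hrec]
      refine (hf k).comp (Measurable.prodMk ?_ ?_)
      · exact (measurable_generatedFiltration hX le_rfl).mono le_sup_left le_rfl
      · exact (comap_measurable (U k)).mono le_sup_right le_rfl
    · exact (measurable_generatedFiltration hX hj).mono le_sup_left le_rfl

/-- The next `σ`-field of `F` is contained in the current one joined with `σ(U k)`, and `U k` is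
independent of the whole past of `U`, which contains the past of `F`. -/
theorem IsGeneratingParameterization.isImmersed [StandardBorelSpace Ω] {μ : Measure Ω}
    [IsProbabilityMeasure μ] {F : Filtration ℕᵒᵈ mΩ} {U : ∀ k, Ω → S k}
    {hU : ∀ k, Measurable (U k)} (h : IsGeneratingParameterization F U hU μ) :
    IsImmersed F (generatedFiltration U hU) μ := by
  refine ⟨h.2, fun k => ?_⟩
  have hG := (generatedFiltration U hU).le (toDual (k + 1))
  have hind := (h.1 k).1
  rw [sup_eq_right.2 (h.2 _)] at hind
  exact (condIndep_iff _ _ _ _ (F.le _) hG μ).1 (condIndep_of_condIndep_of_le_left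
    (condIndep_sup_of_indep (h.2 _) hG (hU k).comap_le hind) (h.1 k).2)

end Filtrations

/-! ### The construction as a parameterized path, and the conclusion -/

namespace Pascal

variable {d : ℕ∞}

open Classical in
/-- The updating function: the vertex designated by the updating rule, if there is one. -/
noncomputable def update (p : Vertex d × ℕ) : Vertex d :=
  if h : ∃ w, IsUpdate p.1 p.2 w then h.choose else 0

theorem IsUpdate.update_eq {v w : Vertex d} {u : ℕ} (h : IsUpdate v u w) : update (v, u) = w := by
  have hex : ∃ w, IsUpdate v u w := ⟨w, h⟩
  rw [update, dif_pos hex]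
  exact hex.choose_spec.eq h

variable {c : ℝ → Coord d} (i₀ : Coord d)

/-- The path with the vertices `vertex c i₀ (code x) k`. -/
noncomputable def pathOf (c : ℝ → Coord d) (x : ℕ → ℝ) : Path d :=
  ⟨fun k => vertex c i₀ (code x) k, fun k => vertex_mem_level c i₀ _ k, fun k => by
    dsimp only
    rw [vertex_succ c i₀ (code_mem_Icc x k)]
    exact adj_add_single _ _⟩

theorem measurable_vertex_code_generatedFiltration (hc : Measurable c) (k : ℕ) :
    Measurable[generatedFiltration (fun k x => code x k) measurable_code (toDual k)]
      fun x => vertex c i₀ (code x) k :=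
  measurable_vertex i₀ hc (U := fun k x => code x k) fun _ hj =>
    measurable_generatedFiltration measurable_code hj

theorem isGeneratingParameterization_code (hc : Measurable c)
    (hc' : MonotoneOn c (Set.Ioo 0 1)) :
    IsGeneratingParameterization
      (generatedFiltration (fun k x => vertex c i₀ (code x) k) (measurable_vertex_code i₀ hc))
      (fun k x => code x k) measurable_code iidUnif :=
  isGeneratingParameterization_of_recursion _ _ iIndepFun_code
    (measurable_vertex_code_generatedFiltration i₀ hc) (f := fun _ => update)
    (fun _ => measurable_of_countable _) fun k => funext fun x =>
      (isUpdate_vertex i₀ hc' (code_mem_Icc x k)).update_eq.symm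

/-- `pathOf` pulls tail events of the walk back to tail events of the independent codes, and
equality of the laws transfers their probabilities. -/
theorem isErgodic_of_map_eq (hc : Measurable c) {μ : Measure (Path d)}
    (hμ : μ.map (fun γ k => walk d k γ) = iidUnif.map fun x k => vertex c i₀ (code x) k) :
    IsErgodic μ := by
  intro A hA
  have htail : MeasurableSet[⨅ k : ℕ,
      generatedFiltration (fun k x => code x k) measurable_code (toDual k)]
      (pathOf i₀ c ⁻¹' A) := by
    rw [MeasurableSpace.measurableSet_iInf] at hA ⊢
    intro k
    have hle : filtration d (toDual k) ≤ MeasurableSpace.map (pathOf i₀ c)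
        (generatedFiltration (fun k x => code x k) measurable_code (toDual k)) := by
      refine (generatedFiltration_le_iff _).2 fun j hj => ?_
      intro s hs
      exact (generatedFiltration (fun k x => code x k) measurable_code).mono
        (toDual_le_toDual.2 hj) _ (measurable_vertex_code_generatedFiltration i₀ hc j hs)
    exact hle _ (hA k)
  have hA' : MeasurableSet A :=
    (filtration d).le (toDual 0) _ ((MeasurableSpace.measurableSet_iInf.1 hA) 0)
  -- The laws are compared on the space of all vertex sequences, so the event is first written as
  -- the trace of a measurable set there.
  obtain ⟨B, hB, rfl⟩ := hA'
  have h1 : μ (Subtype.val ⁻¹' B) = iidUnif (pathOf i₀ c ⁻¹' (Subtype.val ⁻¹' B)) := by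
    have h := congrArg (fun ν => ν B) hμ
    rw [Measure.map_apply (measurable_pi_lambda _ (measurable_walk d)) hB,
      Measure.map_apply (measurable_pi_lambda _ (measurable_vertex_code i₀ hc)) hB] at h
    exact h
  rw [h1]
  exact isKolmogorovian_generatedFiltration measurable_code iIndepFun_code _ htail

end Pascal

theorem proposition8p1 (d : ℕ∞) (hd : 2 ≤ d) (θ : Pascal.Coord d → ℝ)
    (hθ : Pascal.IsProbVector θ) (μ : Measure (Pascal.Path d)) [IsProbabilityMeasure μ]
    (hμ : Pascal.IsMultinomialCentral θ μ) :
    IsStandard (Pascal.filtration d) μ ∧ Pascal.IsErgodic μ ∧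
      ∃ (Ω : Type) (mΩ : MeasurableSpace Ω) (P : Measure Ω)
        (V : ℕ → Ω → Pascal.Vertex d) (hV : ∀ k, Measurable (V k))
        (U : ℕ → Ω → ℕ) (hU : ∀ k, Measurable (U k)),
        IsProbabilityMeasure P ∧
        IdentDistrib (fun γ k => Pascal.walk d k γ) (fun ω k => V k ω) μ P ∧
        (∀ k, P.map (U k) = uniformOn (Set.Icc 1 (k + 1))) ∧
        (∀ k, ∀ᵐ ω ∂P, Pascal.IsUpdate (V (k + 1) ω) (U k ω) (V k ω)) ∧
        IsGeneratingParameterization (generatedFiltration V hV) U hU P := by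
  obtain ⟨c, hc, hc', hcθ⟩ := Pascal.exists_quantile hθ
  -- Any coordinate would do as the default letter.
  let i₀ : Pascal.Coord d := ⟨0, by
    rw [Nat.cast_zero]
    exact lt_of_lt_of_le two_pos hd⟩
  have hmap := hμ.map_walk i₀ hc hcθ
  have hV := Pascal.measurable_vertex_code i₀ hc
  have hident : IdentDistrib (fun γ k => Pascal.walk d k γ)
      (fun x k => Pascal.vertex c i₀ (Pascal.code x) k) μ Pascal.iidUnif :=
    ⟨(measurable_pi_lambda _ (Pascal.measurable_walk d)).aemeasurable,
      (measurable_pi_lambda _ hV).aemeasurable, hmap⟩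
  have hgen := Pascal.isGeneratingParameterization_code i₀ hc hc'
  refine ⟨⟨ℕ → ℝ, inferInstance, Pascal.iidUnif, _, _, inferInstance,
    ⟨_, _, _, _, _, hV, rfl, rfl, hident⟩, ⟨_, _, _, _, Pascal.iIndepFun_code, rfl⟩,
    hgen.isImmersed⟩, Pascal.isErgodic_of_map_eq i₀ hc hmap, ℕ → ℝ, inferInstance,
    Pascal.iidUnif, _, hV, _, Pascal.measurable_code, inferInstance, hident,
    Pascal.map_code_apply, fun k => Filter.Eventually.of_forall fun x =>
      Pascal.isUpdate_vertex i₀ hc' (Pascal.code_mem_Icc x k), hgen⟩
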